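/- All graphs are finite and simple. For a graph $G$, let $\alpha(G)$ be its independence number. $G$ is $\alpha$-critical if $\alpha(G-e)>\alpha(G)$ for every edge $e$ of $G$. For $p\ge 1$, $G$ belongs to the class $\mathbf W_p$ if it has at least $p$ vertices and, for any $p$ pairwise disjoint independent sets $A_1,\dots,A_p$ of $G$ (possibly empty), there are pairwise disjoint independent sets $M_1,\dots,M_p$ of $G$, each of size $\alpha(G)$, with $A_i\subseteq M_i$ for all $i$. Write $e(\cdot)$ for the number of edges and $\delta(\cdot)$ for the minimum degree. Let $p\ge1$, let $G$ be an $n$-vertex $\alpha$-critical graph in $\mathbf W_p$ with $r=\alpha(G)\ge 2$, and let $H=\overline G$ be its complement. Then \[ e(H)\ \ge\ \max\left\{(r-1)n-\binom r2,\ \left\lceil\frac{np(r-1)}2\right\rceil\right\}, \] equivalently, \[ e(G)\ \le\ \binom n2-\max\left\{(r-1)n-\binom r2,\ \left\lceil\frac{np(r-1)}2\right\rceil\right\}. \] Moreover, $\delta(H)\ge p(r-1)$. If $p\ge2$, then $H$ has no conical vertex, that is, no vertex adjacent to every other vertex. If \[ n<\frac{(3r-1)(r-1)}{3r-4}\,p,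 \] then $H$ is complete $r$-partite with all parts of size at least $p$; equivalently, $G$ is the disjoint union of $r$ complete graphs, each of order at least $p$. In particular, if $n=rp$, then $G$ is isomorphic to the disjoint union $rK_p$ of $r$ copies of $K_p$. -/

import Mathlib

/-- The class `W_p` (for `p ≥ 1`): `G` has at least `p` vertices and any `p` pairwise disjoint
independent sets can be enlarged to `p` pairwise disjoint maximum independent sets. -/
def SimpleGraph.InW {V : Type*} [Fintype V] (G : SimpleGraph V) (p : ℕ) : Prop :=
  p ≤ Fintype.card V ∧
    ∀ A : Fin p → Finset V, (∀ i, G.IsIndepSet (A i : Set V)) →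
      (∀ i j, i ≠ j → Disjoint (A i) (A j)) →
      ∃ M : Fin p → Finset V, (∀ i, G.IsNIndepSet G.indepNum (M i)) ∧
        (∀ i j, i ≠ j → Disjoint (M i) (M j)) ∧ ∀ i, A i ⊆ M i

/-- `G` is `α`-critical: deleting any edge (and keeping all vertices) increases the
independence number. -/
def SimpleGraph.IsAlphaCritical {V : Type*} (G : SimpleGraph V) : Prop :=
  ∀ e ∈ G.edgeSet, G.indepNum < (G.deleteEdges {e}).indepNum

/-- The disjoint union of the complete graphs `K_{m 0}, …, K_{m (r-1)}`. -/
def disjointUnionOfCliques {r : ℕ} (m : Fin r → ℕ) : SimpleGraph (Σ i : Fin r, Fin (m i)) where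
  Adj x y := x.1 = y.1 ∧ x ≠ y
  symm := ⟨fun _ _ h => ⟨h.1.symm, h.2.symm⟩⟩
  loopless := ⟨fun _ h => h.2 rfl⟩

/-!
Put `H = Gᶜ`, a graph of clique number `r`. That `G` is `α`-critical says that `H` is
`K_{r+1}`-saturated: every edge `uv` of `G` lies in a set of `r + 1` vertices whose only edge in `G`
is `uv` (`SimpleGraph.IsAlphaCritical.exists_finset`).

* The first edge bound is the Erdős–Hajnal–Moon theorem. The edges of `G`, paired with the
  complements of these `(r + 1)`-sets, form a cross-intersecting system, so Bollobás' set-pair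
  inequality gives `e(G) ≤ (n - r + 1).choose 2`. The case of that inequality needed here,
  `card_le_choose_two_of_setPairs`, is proved by a rank argument: the symmetric polynomials
  `∏ c ∈ B, (X - c) (Y - c)` form a diagonal matrix when evaluated at the pairs, and they lie in a
  space of dimension `(#B + 2).choose 2`.
* The degree bound uses `W_p`: there are `p` disjoint independent sets of size `r - 1` among the
  non-neighbours of a vertex `v`. Given `k < p` of them, enlarge these `k` sets and `{v}` to disjoint
  maximum independent sets; the one that contains `v`, with `v` removed, is a further such set.
  Summing degrees gives the second edge bound.
* A vertex universal in `H` is isolated in `G`, hence lies in every maximum independent set,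
  while `W_2` provides two disjoint ones.
* If `n` is small, the degree bound exceeds the threshold of the Andrásfai–Erdős–Sós theorem, so `H`
  is `r`-colorable. By saturation, vertices of different colors are adjacent in `H`, so the color
  classes are the parts of a complete `r`-partite graph. Each of `p` disjoint maximum independent
  sets of `G` meets every class, so every class has at least `p` vertices.
-/

open Finset Polynomial in
/-- The **Bollobás set-pair inequality** for pairs `{a i, b i}` against sets `B i` of size `k`. -/
theorem card_le_choose_two_of_setPairs {ι V : Type*} [Fintype ι] [Finite V] {k : ℕ}
    (a b : ι → V) (B : ι → Finset V) (hB : ∀ i, #(B i) = k)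
    (ha : ∀ i, a i ∉ B i) (hb : ∀ i, b i ∉ B i)
    (hab : ∀ i j, i ≠ j → a j ∈ B i ∨ b j ∈ B i) :
    Fintype.card ι ≤ (k + 2).choose 2 := by
  classical
  obtain ⟨x, hx⟩ : ∃ x : V → ℚ, Function.Injective x := by
    obtain ⟨m, ⟨e⟩⟩ := Finite.exists_equiv_fin V
    exact ⟨fun v ↦ ((e v : ℕ) : ℚ),
      Nat.cast_injective.comp (Fin.val_injective.comp e.injective)⟩
  let P : ι → ℚ[X] := fun i ↦ ∏ c ∈ B i, (X - C (x c))
  have hdeg (i) : (P i).natDegree < k + 1 := by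
    rw [natDegree_finsetProd_X_sub_C_eq_card, hB]
    exact Nat.lt_succ_self k
  have hroot (i) (v : V) : (P i).eval (x v) = 0 ↔ v ∈ B i := by
    simp [P, eval_prod, prod_eq_zero_iff, sub_eq_zero, hx.eq_iff]
  let D : ι → ℚ := fun i ↦ (P i).eval (x (a i)) * (P i).eval (x (b i))
  let L : Matrix ι (Sym2 (Fin (k + 1))) ℚ := fun i z ↦
    (z.map fun s : Fin (k + 1) ↦ (P i).coeff s).mul
  let R : Matrix (Sym2 (Fin (k + 1))) ι ℚ := fun z j ↦
    ∑ q : Fin (k + 1) × Fin (k + 1) with s(q.1, q.2) = z, x (a j) ^ (q.1 : ℕ) * x (b j) ^ (q.2 : ℕ)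
  have hLR : L * R = Matrix.diagonal D := by
    ext i j
    have hmul : (L * R) i j = (P i).eval (x (a j)) * (P i).eval (x (b j)) := by
      rw [eval_eq_sum_range' (hdeg i), eval_eq_sum_range' (hdeg i), ← Fin.sum_univ_eq_sum_range
        (fun s ↦ (P i).coeff s * x (a j) ^ s), ← Fin.sum_univ_eq_sum_range
        (fun s ↦ (P i).coeff s * x (b j) ^ s), sum_mul_sum, ← Fintype.sum_prod_type',
        Matrix.mul_apply, ← sum_fiberwise (g := fun q : Fin (k + 1) × Fin (k + 1) ↦ s(q.1, q.2))]
      refine sum_congr rfl fun z _ ↦ ?_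
      rw [mul_sum]
      refine sum_congr rfl fun q hq ↦ ?_
      obtain rfl := (mem_filter.1 hq).2
      simp only [L, Sym2.map_mk, Sym2.mul_mk]
      ring
    rw [hmul]
    obtain rfl | hij := eq_or_ne i j
    · simp [D]
    · rw [Matrix.diagonal_apply_ne _ hij, mul_eq_zero, hroot, hroot]
      exact hab i j hij
  have hrank : (Matrix.diagonal D).rank = Fintype.card ι := by
    refine Matrix.rank_of_isUnit _ ((Matrix.isUnit_iff_isUnit_det _).2 ?_)
    rw [Matrix.det_diagonal, isUnit_iff_ne_zero, prod_ne_zero_iff]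
    exact fun i _ ↦ mul_ne_zero ((hroot i _).not.2 (ha i)) ((hroot i _).not.2 (hb i))
  calc Fintype.card ι = (L * R).rank := by rw [hLR, hrank]
    _ ≤ L.rank := Matrix.rank_mul_le_left _ _
    _ ≤ Fintype.card (Sym2 (Fin (k + 1))) := Matrix.rank_le_card_width _
    _ = (k + 2).choose 2 := by rw [Sym2.card, Fintype.card_fin]

namespace SimpleGraph

open Finset

variable {V : Type*} [Fintype V] {G : SimpleGraph V}

/-- In an `α`-critical graph every edge is the only edge inside some set of `α(G) + 1` vertices. -/
theorem IsAlphaCritical.exists_finset (hG : G.IsAlphaCritical) {u v : V} (huv : G.Adj u v) :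
    ∃ S : Finset V, #S = G.indepNum + 1 ∧ u ∈ S ∧ v ∈ S ∧
      ∀ x ∈ S, ∀ y ∈ S, G.Adj x y → s(x, y) = s(u, v) := by
  classical
  obtain ⟨S, hS⟩ := (G.deleteEdges {s(u, v)}).exists_isNIndepSet_indepNum
  have hlt := hG s(u, v) huv
  have honly : ∀ x ∈ S, ∀ y ∈ S, G.Adj x y → s(x, y) = s(u, v) := by
    intro x hx y hy hxy
    by_contra hne
    exact hS.isIndepSet hx hy hxy.ne (deleteEdges_adj.2 ⟨hxy, hne⟩)
  -- Otherwise `S \ {u}`, or `S` itself, would be too large an independent set of `G`.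
  have hindep (T : Finset V) (hTS : T ⊆ S) (hT : u ∉ T ∨ v ∉ T) : #T ≤ G.indepNum := by
    refine IsIndepSet.card_le_indepNum fun x hx y hy _ hxy ↦ ?_
    rcases Sym2.eq_iff.1 (honly x (hTS hx) y (hTS hy) hxy) with ⟨rfl, rfl⟩ | ⟨rfl, rfl⟩
    · exact hT.elim (· hx) (· hy)
    · exact hT.elim (· hy) (· hx)
  have hcard := hS.card_eq
  have hu : u ∈ S := by
    by_contra h
    have := hindep S subset_rfl (.inl h)
    lia
  have hv : v ∈ S := by
    by_contra h
    have := hindep S subset_rfl (.inr h)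
    lia
  have := hindep (S.erase u) (erase_subset _ _) (.inl (notMem_erase u S))
  rw [card_erase_of_mem hu] at this
  exact ⟨S, by lia, hu, hv, honly⟩

/-- The **Erdős–Hajnal–Moon theorem**, stated for the complement of a saturated graph. -/
theorem IsAlphaCritical.card_edgeFinset_le [DecidableEq V] [DecidableRel G.Adj]
    (hG : G.IsAlphaCritical) :
    #G.edgeFinset ≤ (Fintype.card V - G.indepNum + 1).choose 2 := by
  classical
  obtain hE | ⟨e₀, he₀⟩ := G.edgeFinset.eq_empty_or_nonempty
  · simp [hE]
  have key (e : G.edgeSet) : ∃ (u v : V) (S : Finset V), s(u, v) = e.1 ∧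
      #S = G.indepNum + 1 ∧ u ∈ S ∧ v ∈ S ∧
      ∀ x ∈ S, ∀ y ∈ S, G.Adj x y → s(x, y) = s(u, v) := by
    obtain ⟨⟨u, v⟩, he⟩ := e
    obtain ⟨S, hS⟩ := hG.exists_finset (u := u) (v := v) he
    exact ⟨u, v, S, rfl, hS⟩
  choose a b S hab hcard ha hb honly using key
  have hle : G.indepNum + 1 ≤ Fintype.card V :=
    hcard ⟨e₀, mem_edgeFinset.1 he₀⟩ ▸ card_le_univ _
  have := card_le_choose_two_of_setPairs (k := Fintype.card V - (G.indepNum + 1)) a b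
    (fun e ↦ (S e)ᶜ) (fun e ↦ by rw [card_compl, hcard]) (by simpa using ha) (by simpa using hb) ?_
  · rw [edgeFinset_card]
    convert this using 2
    lia
  · intro e f hef
    simp only [mem_compl]
    by_contra! h
    have hf : G.Adj (a f) (b f) := by
      rw [← mem_edgeSet, hab]
      exact f.2
    apply hef
    rw [Subtype.ext_iff, ← hab e, ← hab f, honly e _ h.1 _ h.2 hf]

/-- In a graph of class `W_p`, for each `k ≤ p` there are `k` disjoint independent sets of size
`α(G) - 1` among the non-neighbours of `v`. They are built one at a time, each step taking
the previous sets and `{v}` as prescribed sets in the definition of `W_p`. -/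
theorem InW.exists_disjoint_nonneighbors {p : ℕ} (hW : G.InW p) (v : V) {k : ℕ} (hk : k ≤ p) :
    ∃ S : Fin k → Finset V, (∀ i, G.IsIndepSet (S i)) ∧ (∀ i, #(S i) = G.indepNum - 1) ∧
      (∀ i, ∀ x ∈ S i, v ≠ x ∧ ¬ G.Adj v x) ∧ ∀ i j, i ≠ j → Disjoint (S i) (S j) := by
  classical
  induction k with
  | zero => exact ⟨Fin.elim0, by simp⟩
  | succ k ih =>
    obtain ⟨S, hind, hcard, hv, hdisj⟩ := ih (by lia)
    let A : Fin p → Finset V := fun i ↦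
      if h : (i : ℕ) < k then S ⟨i, h⟩ else if (i : ℕ) = k then {v} else ∅
    obtain ⟨M, hM, hMdisj, hAM⟩ := hW.2 A
      (fun i ↦ by
        simp only [A]
        split_ifs
        · exact hind _
        · simp
        · simp)
      (fun i j hij ↦ by
        have hij' : (i : ℕ) ≠ j := Fin.val_ne_of_ne hij
        simp only [A]
        split_ifs <;> first
          | exact hdisj _ _ (by simpa using hij')
          | exact disjoint_singleton_right.2 fun h ↦ (hv _ _ h).1 rfl
          | exact disjoint_singleton_left.2 fun h ↦ (hv _ _ h).1 rfl
          | lia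
          | simp)
    have hvM : v ∈ M ⟨k, hk⟩ := hAM ⟨k, hk⟩ (by simp [A])
    have hSM (i : Fin k) : S i ⊆ M ⟨i, by lia⟩ := by
      simpa [A] using hAM ⟨i, by lia⟩
    have hnew (i : Fin k) : Disjoint (S i) ((M ⟨k, hk⟩).erase v) :=
      (hMdisj _ _ (by simpa using i.2.ne)).mono (hSM i) (erase_subset _ _)
    refine ⟨Fin.snoc S ((M ⟨k, hk⟩).erase v), ?_, ?_, ?_, ?_⟩
    · refine Fin.lastCases ?_ fun i ↦ ?_
      · simpa using (hM ⟨k, hk⟩).isIndepSet.mono (Set.sdiff_subset (t := {v}))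
      · simpa using hind i
    · refine Fin.lastCases ?_ fun i ↦ ?_
      · simp [card_erase_of_mem hvM, (hM ⟨k, hk⟩).card_eq]
      · simpa using hcard i
    · refine Fin.lastCases ?_ fun i ↦ ?_
      · simp only [Fin.snoc_last, mem_erase]
        exact fun x hx ↦ ⟨hx.1.symm, (hM ⟨k, hk⟩).isIndepSet hvM hx.2 hx.1.symm⟩
      · simpa using hv i
    · refine Fin.lastCases ?_ fun i ↦ ?_ <;> refine Fin.lastCases ?_ fun j ↦ ?_
      · simp
      · simpa using fun _ ↦ (hnew j).symm
      · simpa using hnew i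
      · simpa using hdisj i j

theorem InW.le_minDegree_compl [DecidableEq V] [DecidableRel G.Adj] [Nonempty V] {p : ℕ}
    (hW : G.InW p) : p * (G.indepNum - 1) ≤ Gᶜ.minDegree := by
  refine Gᶜ.le_minDegree_of_forall_le_degree _ fun v ↦ ?_
  obtain ⟨S, -, hcard, hv, hdisj⟩ := hW.exists_disjoint_nonneighbors v le_rfl
  calc p * (G.indepNum - 1) = #(univ.biUnion S) := by
        rw [card_biUnion fun i _ j _ hij ↦ hdisj i j hij]
        simp [hcard]
    _ ≤ #(Gᶜ.neighborFinset v) := card_le_card <| biUnion_subset.2 fun i _ x hx ↦ by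
        simpa using hv i x hx
    _ = Gᶜ.degree v := card_neighborFinset_eq_degree ..

theorem InW.exists_disjoint_isNIndepSet {p : ℕ} (hW : G.InW p) :
    ∃ M : Fin p → Finset V, (∀ i, G.IsNIndepSet G.indepNum (M i)) ∧
      ∀ i j, i ≠ j → Disjoint (M i) (M j) := by
  obtain ⟨M, hM, hdisj, -⟩ := hW.2 (fun _ ↦ ∅) (by simp) (by simp)
  exact ⟨M, hM, hdisj⟩

theorem InW.not_isUniversal_compl {p : ℕ} (hW : G.InW p) (hp : 2 ≤ p) (v : V) :
    ¬ Gᶜ.IsUniversal v := by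
  classical
  intro hv
  obtain ⟨M, hM, hdisj⟩ := hW.exists_disjoint_isNIndepSet
  have hmem (i) : v ∈ M i := by
    by_contra hvi
    have hind : G.IsIndepSet (insert v (M i) : Finset V) := by
      rw [← isClique_compl, coe_insert, isClique_insert]
      exact ⟨G.isClique_compl.2 (hM i).isIndepSet, fun w _ hvw ↦ hv hvw⟩
    have := hind.card_le_indepNum
    rw [card_insert_of_notMem hvi, (hM i).card_eq] at this
    lia
  exact Finset.disjoint_left.1 (hdisj ⟨0, by lia⟩ ⟨1, by lia⟩ (by simp)) (hmem _) (hmem _)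

/-- If the complement of an `α`-critical graph has a coloring with `α(G)` colors, then `G` is
the disjoint union of complete graphs on the color classes. -/
theorem IsAlphaCritical.adj_iff_of_coloring (hG : G.IsAlphaCritical) {r : ℕ}
    (hr : r = G.indepNum) (C : Gᶜ.Coloring (Fin r)) (u v : V) :
    G.Adj u v ↔ C u = C v ∧ u ≠ v := by
  have hadj {x y : V} (h : C x = C y) (hne : x ≠ y) : G.Adj x y := by
    by_contra hxy
    exact C.valid (G.compl_adj x y |>.2 ⟨hne, hxy⟩) h
  refine ⟨fun huv ↦ ⟨?_, huv.ne⟩, fun h ↦ hadj h.1 h.2⟩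
  by_contra hC
  obtain ⟨S, hcard, -, -, honly⟩ := hG.exists_finset huv
  have hinj : Set.InjOn C S := by
    intro x hx y hy hxy
    by_contra hne
    rcases Sym2.eq_iff.1 (honly x hx y hy (hadj hxy hne)) with ⟨rfl, rfl⟩ | ⟨rfl, rfl⟩
    · exact hC hxy
    · exact hC hxy.symm
  have := card_le_card_of_injOn C (fun x _ ↦ mem_univ (C x)) hinj
  rw [card_univ, Fintype.card_fin] at this
  lia

theorem InW.le_card_fiber {p r : ℕ} (hW : G.InW p) (hr : r = G.indepNum) (c : V → Fin r)
    (hc : ∀ u v, G.Adj u v ↔ c u = c v ∧ u ≠ v) (i : Fin r) :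
    p ≤ Fintype.card {v // c v = i} := by
  classical
  obtain ⟨M, hM, hdisj⟩ := hW.exists_disjoint_isNIndepSet
  have hmeet (j) : ∃ v ∈ M j, c v = i := by
    have hinj : Set.InjOn c (M j) := by
      intro x hx y hy hxy
      by_contra hne
      exact (hM j).isIndepSet hx hy hne ((hc x y).2 ⟨hxy, hne⟩)
    have himage : (M j).image c = univ := by
      rw [← card_eq_iff_eq_univ, card_image_of_injOn hinj, (hM j).card_eq, Fintype.card_fin, hr]
    exact mem_image.1 (himage ▸ mem_univ i)
  choose f hfM hfi using hmeet
  have hf : Function.Injective fun j ↦ (⟨f j, hfi j⟩ : {v // c v = i}) := by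
    intro j k hjk
    by_contra hne
    have hjk' : f j = f k := congrArg Subtype.val hjk
    exact Finset.disjoint_left.1 (hdisj j k hne) (hfM j) (hjk' ▸ hfM k)
  simpa using Fintype.card_le_of_injective _ hf

theorem card_edgeFinset_add_card_edgeFinset_compl [DecidableEq V] [DecidableRel G.Adj] :
    #G.edgeFinset + #Gᶜ.edgeFinset = (Fintype.card V).choose 2 := by
  classical
  rw [← card_edgeFinset_top_eq_card_choose_two, ← card_union_of_disjoint
    (disjoint_edgeFinset.2 disjoint_compl_right), ← edgeFinset_sup]
  congr! 1
  rw [← coe_inj, coe_edgeFinset, coe_edgeFinset, sup_compl_eq_top]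

end SimpleGraph

open SimpleGraph Finset in
theorem corollary6p4 {V : Type*} [Fintype V] [DecidableEq V]
    (G : SimpleGraph V) [DecidableRel G.Adj] (n r p : ℕ)
    (hn : n = Fintype.card V) (hr : r = G.indepNum) (hr2 : 2 ≤ r) (hp : 1 ≤ p)
    (hcrit : G.IsAlphaCritical) (hW : G.InW p) :
    -- lower bound on the number of edges of the complement
    (max (((r : ℤ) - 1) * n - (r.choose 2 : ℤ)) ⌈(n : ℚ) * p * ((r : ℚ) - 1) / 2⌉
        ≤ (Gᶜ.edgeFinset.card : ℤ)) ∧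
    -- upper bound on the number of edges of `G`
    ((G.edgeFinset.card : ℤ) ≤ (n.choose 2 : ℤ) -
        max (((r : ℤ) - 1) * n - (r.choose 2 : ℤ)) ⌈(n : ℚ) * p * ((r : ℚ) - 1) / 2⌉) ∧
    -- minimum degree of the complement
    p * (r - 1) ≤ Gᶜ.minDegree ∧
    -- no conical vertex
    (2 ≤ p → ¬ ∃ v : V, Gᶜ.IsUniversal v) ∧
    -- rigidity for small order
    ((n : ℚ) < (3 * (r : ℚ) - 1) * ((r : ℚ) - 1) / (3 * (r : ℚ) - 4) * p →
      ∃ m : Fin r → ℕ, (∀ i, p ≤ m i) ∧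
        Nonempty (Gᶜ ≃g SimpleGraph.completeMultipartiteGraph (fun i : Fin r => Fin (m i))) ∧
        Nonempty (G ≃g disjointUnionOfCliques m)) ∧
    (n = r * p → Nonempty (G ≃g disjointUnionOfCliques (fun _ : Fin r => p))) := by
  obtain ⟨I, hI⟩ := G.exists_isNIndepSet_indepNum
  have hrn : r ≤ n := by
    rw [hr, hn, ← hI.card_eq]
    exact card_le_univ I
  have : Nonempty V := Fintype.card_pos_iff.1 (by lia)
  have hdeg : p * (r - 1) ≤ Gᶜ.minDegree := hr ▸ hW.le_minDegree_compl
  have hsum := G.card_edgeFinset_add_card_edgeFinset_compl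
  rw [← hn] at hsum
  have hEHM : ((r : ℤ) - 1) * n - (r.choose 2 : ℤ) ≤ (#Gᶜ.edgeFinset : ℤ) := by
    have hG := hcrit.card_edgeFinset_le
    rw [← hn, ← hr] at hG
    obtain ⟨d, rfl⟩ := Nat.exists_eq_add_of_le hrn
    rw [Nat.add_sub_cancel_left] at hG
    have hsum' : (#G.edgeFinset : ℚ) + #Gᶜ.edgeFinset = ((r + d).choose 2 : ℕ) := mod_cast hsum
    have hG' : (#G.edgeFinset : ℚ) ≤ ((d + 1).choose 2 : ℕ) := mod_cast hG
    rw [Nat.cast_choose_two] at hsum' hG'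
    have hgoal : ((r : ℚ) - 1) * (r + d : ℕ) - (r.choose 2 : ℕ) ≤ #Gᶜ.edgeFinset := by
      rw [Nat.cast_choose_two]
      push_cast at *
      linarith
    exact_mod_cast hgoal
  have hHandshake : ⌈(n : ℚ) * p * ((r : ℚ) - 1) / 2⌉ ≤ (#Gᶜ.edgeFinset : ℤ) := by
    have h : n * (p * (r - 1)) ≤ 2 * #Gᶜ.edgeFinset := by
      rw [← sum_degrees_eq_twice_card_edges, hn, ← smul_eq_mul, ← card_univ]
      exact card_nsmul_le_sum _ _ _ fun v _ ↦ hdeg.trans (Gᶜ.minDegree_le_degree v)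
    have h' : (n : ℚ) * (p * ((r - 1 : ℕ) : ℚ)) ≤ 2 * #Gᶜ.edgeFinset := mod_cast h
    rw [Nat.cast_pred (by lia)] at h'
    rw [Int.ceil_le, Int.cast_natCast]
    linarith
  have hr2' : (2 : ℚ) ≤ r := mod_cast hr2
  have hrigid : (n : ℚ) < (3 * (r : ℚ) - 1) * ((r : ℚ) - 1) / (3 * (r : ℚ) - 4) * p →
      ∃ m : Fin r → ℕ, (∀ i, p ≤ m i) ∧
        Nonempty (Gᶜ ≃g SimpleGraph.completeMultipartiteGraph (fun i : Fin r => Fin (m i))) ∧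
        Nonempty (G ≃g disjointUnionOfCliques m) := by
    intro hlt
    have hfree : Gᶜ.CliqueFree (r + 1) := by
      intro S hS
      have := (G.isNClique_compl.1 hS).isIndepSet.card_le_indepNum
      rw [hS.card_eq] at this
      lia
    have hAES : (3 * r - 4) * Fintype.card V / (3 * r - 1) < Gᶜ.minDegree := by
      refine Nat.div_lt_of_lt_mul (lt_of_lt_of_le ?_ (Nat.mul_le_mul_left (3 * r - 1) hdeg))
      rw [div_mul_eq_mul_div, lt_div_iff₀ (by linarith)] at hlt
      rw [← hn, ← Nat.cast_lt (α := ℚ)]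
      push_cast [Nat.cast_sub (show 4 ≤ 3 * r by lia), Nat.cast_sub (show 1 ≤ 3 * r by lia),
        Nat.cast_sub (show 1 ≤ r by lia)]
      linarith
    obtain ⟨C⟩ := colorable_of_cliqueFree_lt_minDegree hfree hAES
    have hC := hcrit.adj_iff_of_coloring hr C
    let e : V ≃ Σ i : Fin r, Fin (Fintype.card {v // C v = i}) :=
      (Equiv.sigmaFiberEquiv C).symm.trans (Equiv.sigmaCongrRight fun i ↦ Fintype.equivFin _)
    have he (v : V) : (e v).1 = C v := rfl
    refine ⟨fun i ↦ Fintype.card {v // C v = i}, hW.le_card_fiber hr C hC, ⟨⟨e, ?_⟩⟩, ⟨⟨e, ?_⟩⟩⟩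
    · intro u v
      change (e u).1 ≠ (e v).1 ↔ _
      rw [he, he, compl_adj, hC]
      grind
    · intro u v
      change (e u).1 = (e v).1 ∧ e u ≠ e v ↔ _
      rw [he, he, hC, e.injective.ne_iff]
  refine ⟨max_le hEHM hHandshake, ?_, hdeg, fun hp2 ⟨v, hv⟩ ↦ hW.not_isUniversal_compl hp2 v hv,
    hrigid, fun hnrp ↦ ?_⟩
  · have hsum' : (#G.edgeFinset : ℤ) + #Gᶜ.edgeFinset = (n.choose 2 : ℕ) := mod_cast hsum
    have := max_le hEHM hHandshake
    linarith
  · obtain ⟨m, hm, -, ⟨f⟩⟩ := hrigid (by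
      rw [hnrp, div_mul_eq_mul_div, lt_div_iff₀ (by linarith)]
      push_cast
      have : (1 : ℚ) ≤ p := mod_cast hp
      nlinarith)
    have hcard : ∑ i, m i = ∑ _i : Fin r, p := by
      have := Fintype.card_congr f.toEquiv
      rw [Fintype.card_sigma, ← hn, hnrp] at this
      simpa using this.symm
    have hmp : m = fun _ ↦ p := by
      funext i
      exact ((sum_eq_sum_iff_of_le fun i _ ↦ hm i).1 hcard.symm i (mem_univ i)).symm
    subst hmp
    exact ⟨f⟩
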